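/- Let $n\ge 1$, let $c\ne 0$ be a real constant, and let $u\in L^\infty(\mathbb R^n)$ be a real-valued function, not almost everywhere zero, satisfying $-\Delta u=c^2u$ on $\mathbb R^n$ in the weak (distributional) sense, i.e. $$\int_{\mathbb R^n} u\,(-\Delta\varphi)\,dx=\int_{\mathbb R^n}c^2u\,\varphi\,dx\qquad\text{for all }\varphi\in C_c^\infty(\mathbb R^n).$$ Then $u$ changes sign near infinity: for every $R$, both sets $\{x:|x|>R,\ u(x)>0\}$ and $\{x:|x|>R,\ u(x)<0\}$ have positive Lebesgue measure. (Equivalently, a bounded weak solution that is almost everywhere $\ge 0$, or almost everywhere $\le 0$, outside some ball vanishes almost everywhere on $\mathbb R^n$.) -/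

import Mathlib

open MeasureTheory
open scoped ENNReal ContDiff Laplacian

/-- `u` is a real-valued weak (distributional) solution of `-Δ u = V u` on `ℝⁿ`. -/
def IsWeakSolution {n : ℕ} (V u : EuclideanSpace ℝ (Fin n) → ℝ) : Prop :=
  LocallyIntegrable u volume ∧ LocallyIntegrable (fun x => V x * u x) volume ∧
    ∀ φ : EuclideanSpace ℝ (Fin n) → ℝ, ContDiff ℝ ∞ φ → HasCompactSupport φ →
      ∫ x, u x * (-(Δ φ) x) = ∫ x, V x * u x * φ x

/-- `u` is a (nontrivial) eigenfunction of `-Δ` on `ℝⁿ` with eigenvalue `a`,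
in the weak sense. As usual for elements of `L¹_loc`, nontrivial means not a.e. zero. -/
def IsEigenfunction {n : ℕ} (a : ℝ) (u : EuclideanSpace ℝ (Fin n) → ℝ) : Prop :=
  IsWeakSolution (fun _ => a) u ∧ ¬ (u =ᵐ[volume] 0)

/-- `u` changes sign near infinity: outside every ball it is neither a.e. nonnegative
nor a.e. nonpositive. -/
def ChangesSignNearInfinity {n : ℕ} (u : EuclideanSpace ℝ (Fin n) → ℝ) : Prop :=
  ∀ R : ℝ, 0 < volume {x | R < ‖x‖ ∧ 0 < u x} ∧ 0 < volume {x | R < ‖x‖ ∧ u x < 0}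

/-! Write `a = c ^ 2` and suppose `u ≥ 0` a.e. outside a ball. Testing the equation against the
Gaussian `exp (-ε‖x‖²)` shows that `u` integrates to zero against the weight `(a - 2εn + 4ε²‖x‖²)
exp (-ε‖x‖²)`. For small `ε` this weight is nonnegative, so the weighted mass of `u` outside the
ball is at most that of `|u|` inside, which is bounded uniformly in `ε`. As `ε → 0` the weight tends
to `a > 0`, and Fatou's lemma gives `u ∈ L¹` (`IsWeakSolution.integrable_of_nonneg_near_infinity`).

For integrable `u`, plane waves are admissible test functions, and they show that the Fourier
transform vanishes off a sphere. A sphere of nonzero radius is null, so `u = 0` a.e.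
(`IsWeakSolution.ae_eq_zero_of_integrable`), a contradiction. The other sign follows by passing to
`-u`. Neither Gaussians nor plane waves need have compact support;
`IsWeakSolution.integral_mul_laplacian` admits them by a cutoff argument. -/

open Filter Topology

/-! ### Calculus of the Laplacian, and cutoff functions. -/

section Laplacian

variable {E ι : Type*} [NormedAddCommGroup E] [InnerProductSpace ℝ E] [FiniteDimensional ℝ E]
  [Fintype ι]

/-- The Laplacian as the sum of the pure second partial derivatives. -/
lemma laplacian_eq_sum_fderiv_fderiv (b : OrthonormalBasis ι ℝ E) {f : E → ℝ}
    (hf : ContDiff ℝ 2 f) (x : E) :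
    (Δ f) x = ∑ i, fderiv ℝ (fun y => fderiv ℝ f y (b i)) x (b i) := by
  have hd : DifferentiableAt ℝ (fderiv ℝ f) x :=
    (hf.fderiv_right (m := 1) (by norm_num)).differentiable one_ne_zero x
  rw [InnerProductSpace.laplacian_eq_iteratedFDeriv_orthonormalBasis f b]
  refine Finset.sum_congr rfl fun i _ => ?_
  rw [iteratedFDeriv_two_apply, fderiv_clm_apply hd (by fun_prop)]
  simp

/-- The Leibniz rule for the Laplacian. -/
lemma laplacian_mul (b : OrthonormalBasis ι ℝ E) {f g : E → ℝ}
    (hf : ContDiff ℝ 2 f) (hg : ContDiff ℝ 2 g) (x : E) :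
    (Δ (fun y => f y * g y)) x = f x * (Δ g) x
      + 2 * ∑ i, fderiv ℝ f x (b i) * fderiv ℝ g x (b i) + g x * (Δ f) x := by
  have df : Differentiable ℝ f := hf.differentiable two_ne_zero
  have dg : Differentiable ℝ g := hg.differentiable two_ne_zero
  have df' : Differentiable ℝ (fderiv ℝ f) :=
    (hf.fderiv_right (m := 1) (by norm_num)).differentiable one_ne_zero
  have dg' : Differentiable ℝ (fderiv ℝ g) :=
    (hg.fderiv_right (m := 1) (by norm_num)).differentiable one_ne_zero
  rw [laplacian_eq_sum_fderiv_fderiv b (hf.mul hg), laplacian_eq_sum_fderiv_fderiv b hf,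
    laplacian_eq_sum_fderiv_fderiv b hg, Finset.mul_sum, Finset.mul_sum, Finset.mul_sum,
    ← Finset.sum_add_distrib, ← Finset.sum_add_distrib]
  refine Finset.sum_congr rfl fun i _ => ?_
  have h1 : (fun y => fderiv ℝ (fun z => f z * g z) y (b i))
      = fun y => f y * fderiv ℝ g y (b i) + g y * fderiv ℝ f y (b i) := by
    funext y
    rw [fderiv_fun_mul (df y) (dg y)]
    simp
  have df'' : Differentiable ℝ fun y => fderiv ℝ f y (b i) := df'.clm_apply (by fun_prop)
  have dg'' : Differentiable ℝ fun y => fderiv ℝ g y (b i) := dg'.clm_apply (by fun_prop)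
  rw [h1, fderiv_fun_add (by fun_prop) (by fun_prop), fderiv_fun_mul (df x) (dg'' x),
    fderiv_fun_mul (dg x) (df'' x)]
  simp
  ring

lemma continuous_laplacian {f : E → ℝ} (hf : ContDiff ℝ 2 f) : Continuous (Δ f) := by
  have h : (Δ f) = fun x => ∑ i, iteratedFDeriv ℝ 2 f x
      ![stdOrthonormalBasis ℝ E i, stdOrthonormalBasis ℝ E i] :=
    InnerProductSpace.laplacian_eq_iteratedFDeriv_stdOrthonormalBasis f
  have := hf.continuous_iteratedFDeriv (m := 2) le_rfl
  rw [h]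
  fun_prop

/-- Used with `0 < a ≤ 1`: spreading out a fixed bump does not increase the bound on its Laplacian.
-/
lemma laplacian_comp_smul {f : E → ℝ} (hf : ContDiff ℝ 2 f) (a : ℝ) (x : E) :
    (Δ (fun y => f (a • y))) x = a ^ 2 * (Δ f) (a • x) := by
  have hfa : ContDiff ℝ 2 (fun y => f (a • y)) := by fun_prop
  rw [laplacian_eq_sum_fderiv_fderiv (stdOrthonormalBasis ℝ E) hfa,
    laplacian_eq_sum_fderiv_fderiv (stdOrthonormalBasis ℝ E) hf, Finset.mul_sum]
  refine Finset.sum_congr rfl fun i _ => ?_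
  have h1 : (fun y => fderiv ℝ (fun z => f (a • z)) y (stdOrthonormalBasis ℝ E i))
      = fun y => a • (fun z => fderiv ℝ f z (stdOrthonormalBasis ℝ E i)) (a • y) := by
    funext y
    rw [fderiv_comp_smul]
    simp
  have hd : Differentiable ℝ (fun z => fderiv ℝ f z (stdOrthonormalBasis ℝ E i)) :=
    ((hf.fderiv_right (m := 1) (by norm_num)).differentiable one_ne_zero).clm_apply (by fun_prop)
  rw [h1, fderiv_fun_const_smul (by fun_prop),
    fderiv_comp_smul (f := fun z => fderiv ℝ f z (stdOrthonormalBasis ℝ E i))]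
  simp
  ring

/-- Smooth compactly supported cutoffs with uniformly bounded derivatives up to order two,
that are eventually equal to one near each point. -/
lemma exists_smooth_cutoffs (E : Type*) [NormedAddCommGroup E] [InnerProductSpace ℝ E]
    [FiniteDimensional ℝ E] :
    ∃ (χ : ℕ → E → ℝ) (C : ℝ), (∀ k, ContDiff ℝ ∞ (χ k)) ∧ (∀ k, HasCompactSupport (χ k)) ∧
      (∀ k x, |χ k x| ≤ C) ∧ (∀ k x, ‖fderiv ℝ (χ k) x‖ ≤ C) ∧ (∀ k x, |(Δ (χ k)) x| ≤ C) ∧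
      ∀ x, ∀ᶠ k in atTop, χ k =ᶠ[𝓝 x] fun _ => 1 := by
  let f : ContDiffBump (0 : E) := ⟨1, 2, one_pos, one_lt_two⟩
  have hf : ContDiff ℝ ∞ f := f.contDiff
  have hf2 : ContDiff ℝ 2 f := f.contDiff
  have hlap : HasCompactSupport (Δ (f : E → ℝ)) := by
    refine f.hasCompactSupport.mono' fun x hx => ?_
    by_contra h
    have h0 : (f : E → ℝ) =ᶠ[𝓝 x] fun _ => 0 := notMem_tsupport_iff_eventuallyEq.1 h
    exact hx (by simpa using (InnerProductSpace.laplacian_congr_nhds h0).eq_of_nhds)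
  obtain ⟨C₁, h₁⟩ := f.hasCompactSupport.exists_bound_of_continuous hf.continuous
  obtain ⟨C₂, h₂⟩ := (f.hasCompactSupport.fderiv (𝕜 := ℝ)).exists_bound_of_continuous
    (hf.continuous_fderiv (by simp))
  obtain ⟨C₃, h₃⟩ := hlap.exists_bound_of_continuous (continuous_laplacian hf2)
  -- Dilation factors tending to zero, so the region where the bump is one exhausts the space; being
  -- at most one, they never enlarge derivatives.
  let a : ℕ → ℝ := fun k => 1 / ((k : ℝ) + 1)
  have ha : ∀ k, 0 < a k := fun k => by positivity
  have ha1 : ∀ k, a k ≤ 1 := fun k => by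
    simp only [a]
    rw [div_le_one (by positivity)]
    linarith [(Nat.cast_nonneg k : (0 : ℝ) ≤ k)]
  refine ⟨fun k x => f (a k • x), max C₁ (max C₂ C₃), fun k => by fun_prop, fun k => ?_,
    fun k x => ?_, fun k x => ?_, fun k x => ?_, fun x => ?_⟩
  · exact f.hasCompactSupport.comp_smul (ha k).ne'
  · exact (h₁ _).trans (le_max_left _ _)
  · rw [fderiv_comp_smul, norm_smul, Real.norm_of_nonneg (ha k).le]
    calc a k * ‖fderiv ℝ f (a k • x)‖ ≤ 1 * ‖fderiv ℝ f (a k • x)‖ := by gcongr; exact ha1 k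
      _ ≤ _ := by
        rw [one_mul]
        exact (h₂ _).trans ((le_max_left _ _).trans (le_max_right _ _))
  · rw [laplacian_comp_smul hf2, abs_mul, abs_of_nonneg (by positivity)]
    calc a k ^ 2 * |(Δ (f : E → ℝ)) (a k • x)| ≤ 1 * |(Δ (f : E → ℝ)) (a k • x)| := by
          gcongr
          exact pow_le_one₀ (ha k).le (ha1 k)
      _ ≤ _ := by
        rw [one_mul]
        exact (h₃ _).trans ((le_max_right _ _).trans (le_max_right _ _))
  · have h0 : Tendsto (fun k => a k * ‖x‖) atTop (𝓝 0) := by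
      simpa [a] using (tendsto_one_div_add_atTop_nhds_zero_nat (𝕜 := ℝ)).mul_const ‖x‖
    filter_upwards [h0.eventually_lt_const one_pos] with k hk
    have hc : ContinuousAt (fun y : E => ‖a k • y‖) x := by fun_prop
    have hx : ‖a k • x‖ < 1 := by rwa [norm_smul, Real.norm_of_nonneg (ha k).le]
    filter_upwards [hc.eventually_lt_const hx] with y hy
    exact f.one_of_mem_closedBall (by simpa [f] using hy.le)

end Laplacian

/-! ### Test functions without compact support. -/

/-- The weak equation `-Δ u = a u` may be tested against any smooth function `g` for which the
products of `u` with `g` and its derivatives up to order two are integrable. -/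
lemma IsWeakSolution.integral_mul_laplacian {n : ℕ} {a : ℝ} {u : EuclideanSpace ℝ (Fin n) → ℝ}
    (hu : IsWeakSolution (fun _ => a) u) {g : EuclideanSpace ℝ (Fin n) → ℝ}
    (hg : ContDiff ℝ ∞ g) (h0 : Integrable (fun x => u x * g x))
    (h1 : ∀ i, Integrable fun x => u x * fderiv ℝ g x (EuclideanSpace.basisFun (Fin n) ℝ i))
    (h2 : Integrable (fun x => u x * (Δ g) x)) :
    ∫ x, u x * (Δ g) x = -(a * ∫ x, u x * g x) := by
  obtain ⟨χ, C, hχs, hχc, hχ0, hχ1, hχ2, hχ⟩ := exists_smooth_cutoffs (EuclideanSpace ℝ (Fin n))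
  set b := EuclideanSpace.basisFun (Fin n) ℝ
  have hum : AEStronglyMeasurable u := hu.1.aestronglyMeasurable
  have hg2 : ContDiff ℝ 2 g := contDiff_infty.1 hg 2
  have hχs2 : ∀ k, ContDiff ℝ 2 (χ k) := fun k => contDiff_infty.1 (hχs k) 2
  have hsm : ∀ k, ContDiff ℝ ∞ (fun x => χ k x * g x) := fun k => (hχs k).mul hg
  have hsm2 : ∀ k, ContDiff ℝ 2 (fun x => χ k x * g x) := fun k => (hχs2 k).mul hg2
  have key : ∀ k, ∫ x, u x * -(Δ (fun y => χ k y * g y)) x = ∫ x, a * u x * (χ k x * g x) :=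
    fun k => hu.2.2 _ (hsm k) (hχc k).mul_right
  have limR : Tendsto (fun k => ∫ x, a * u x * (χ k x * g x)) atTop
      (𝓝 (∫ x, a * (u x * g x))) := by
    refine tendsto_integral_of_dominated_convergence (fun x => |a| * C * ‖u x * g x‖)
      (fun k => (hum.const_mul a).mul (hsm k).continuous.aestronglyMeasurable)
      (h0.norm.const_mul _) (fun k => .of_forall fun x => ?_) (.of_forall fun x => ?_)
    · have : a * u x * (χ k x * g x) = a * χ k x * (u x * g x) := by ring
      rw [this, norm_mul, norm_mul]
      gcongr
      · exact le_rfl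
      · exact hχ0 k x
    · refine tendsto_const_nhds.congr' ?_
      filter_upwards [hχ x] with k hk
      rw [hk.eq_of_nhds]
      ring
  -- The cutoff derivatives need only be bounded: the Leibniz rule then gives a dominating function
  -- from `h0`, `h1`, `h2`. Pointwise, `χ k * g` eventually coincides with `g` near `x`, so the
  -- Laplacians agree there.
  have limL : Tendsto (fun k => ∫ x, u x * -(Δ (fun y => χ k y * g y)) x) atTop
      (𝓝 (∫ x, -(u x * (Δ g) x))) := by
    refine tendsto_integral_of_dominated_convergence
      (fun x => C * ‖u x * (Δ g) x‖ + 2 * ∑ i, C * ‖u x * fderiv ℝ g x (b i)‖ + C * ‖u x * g x‖)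
      (fun k => hum.mul (continuous_laplacian (hsm2 k)).neg.aestronglyMeasurable)
      (((h2.norm.const_mul _).add
        ((integrable_finsetSum _ fun i _ => (h1 i).norm.const_mul C).const_mul 2)).add
        (h0.norm.const_mul _)) (fun k => .of_forall fun x => ?_) (.of_forall fun x => ?_)
    · have : u x * -(Δ (fun y => χ k y * g y)) x = -(χ k x * (u x * (Δ g) x)
          + 2 * ∑ i, fderiv ℝ (χ k) x (b i) * (u x * fderiv ℝ g x (b i))
          + (Δ (χ k)) x * (u x * g x)) := by
        have hs : ∑ i, fderiv ℝ (χ k) x (b i) * (u x * fderiv ℝ g x (b i))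
            = u x * ∑ i, fderiv ℝ (χ k) x (b i) * fderiv ℝ g x (b i) := by
          rw [Finset.mul_sum]
          exact Finset.sum_congr rfl fun i _ => by ring
        rw [laplacian_mul b (hχs2 k) hg2, hs]
        ring
      rw [this, norm_neg]
      refine (norm_add₃_le).trans ?_
      have e2 : ‖(2 : ℝ) * ∑ i, fderiv ℝ (χ k) x (b i) * (u x * fderiv ℝ g x (b i))‖
          ≤ 2 * ∑ i, C * ‖u x * fderiv ℝ g x (b i)‖ := by
        rw [norm_mul, Real.norm_ofNat]
        gcongr
        refine norm_sum_le_of_le _ fun i _ => ?_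
        rw [norm_mul]
        gcongr
        refine ((fderiv ℝ (χ k) x).le_opNorm (b i)).trans ?_
        rw [b.orthonormal.1 i, mul_one]
        exact hχ1 k x
      have e1 : ‖χ k x * (u x * (Δ g) x)‖ ≤ C * ‖u x * (Δ g) x‖ := by
        rw [norm_mul]
        gcongr
        exact hχ0 k x
      have e3 : ‖(Δ (χ k)) x * (u x * g x)‖ ≤ C * ‖u x * g x‖ := by
        rw [norm_mul]
        gcongr
        exact hχ2 k x
      gcongr
    · refine tendsto_const_nhds.congr' ?_
      filter_upwards [hχ x] with k hk
      have : (fun y => χ k y * g y) =ᶠ[𝓝 x] g := by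
        filter_upwards [hk] with y hy
        rw [hy, one_mul]
      rw [(InnerProductSpace.laplacian_congr_nhds this).eq_of_nhds]
      ring
  have heq := tendsto_nhds_unique limL (by simpa only [key] using limR)
  rw [integral_neg, integral_const_mul] at heq
  linarith

/-! ### Laplacians of Gaussians and plane waves. -/

section ExplicitLaplacians

variable {E : Type*} [NormedAddCommGroup E] [InnerProductSpace ℝ E]

lemma fderiv_exp_neg_mul_norm_sq (ε : ℝ) (x v : E) :
    fderiv ℝ (fun y : E => Real.exp (-ε * ‖y‖ ^ 2)) x v
      = -2 * ε * inner ℝ x v * Real.exp (-ε * ‖x‖ ^ 2) := by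
  have h : HasFDerivAt (fun y : E => -ε * ‖y‖ ^ 2) (-ε • (2 • innerSL ℝ x)) x :=
    (hasStrictFDerivAt_norm_sq x).hasFDerivAt.const_mul (-ε)
  rw [h.exp.fderiv]
  simp
  ring

lemma laplacian_exp_neg_mul_norm_sq [FiniteDimensional ℝ E] (ε : ℝ) (x : E) :
    (Δ (fun y : E => Real.exp (-ε * ‖y‖ ^ 2))) x
      = (4 * ε ^ 2 * ‖x‖ ^ 2 - 2 * ε * Module.finrank ℝ E) * Real.exp (-ε * ‖x‖ ^ 2) := by
  let b := stdOrthonormalBasis ℝ E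
  have hs : ContDiff ℝ 2 (fun y : E => Real.exp (-ε * ‖y‖ ^ 2)) :=
    (contDiff_const.mul (contDiff_norm_sq ℝ)).exp
  rw [laplacian_eq_sum_fderiv_fderiv b hs]
  simp only [fderiv_exp_neg_mul_norm_sq]
  have hd : Differentiable ℝ (fun y : E => Real.exp (-ε * ‖y‖ ^ 2)) :=
    hs.differentiable two_ne_zero
  have h : ∀ i, fderiv ℝ (fun y => -2 * ε * inner ℝ y (b i) * Real.exp (-ε * ‖y‖ ^ 2)) x (b i)
      = (4 * ε ^ 2 * inner ℝ x (b i) ^ 2 - 2 * ε) * Real.exp (-ε * ‖x‖ ^ 2) := by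
    intro i
    have hl : HasFDerivAt (fun y : E => -2 * ε * inner ℝ y (b i))
        ((-2 * ε) • innerSL ℝ (b i)) x := by
      have := (innerSL ℝ (b i)).hasFDerivAt (x := x)
      refine (this.const_mul (-2 * ε)).congr_of_eventuallyEq (.of_forall fun y => ?_)
      simp [real_inner_comm]
    rw [fderiv_fun_mul hl.differentiableAt (hd x), hl.fderiv]
    simp only [add_apply, smul_apply, fderiv_exp_neg_mul_norm_sq, smul_eq_mul, innerSL_apply_apply,
      real_inner_self_eq_norm_sq, b.orthonormal.1 i]
    ring
  rw [Finset.sum_congr rfl fun i _ => h i, ← Finset.sum_mul, Finset.sum_sub_distrib,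
    ← Finset.mul_sum]
  have hp : ∑ i, inner ℝ x (b i) ^ 2 = ‖x‖ ^ 2 := by
    rw [← b.sum_sq_norm_inner_left x]
    simp
  rw [hp]
  simp
  ring_nf

lemma fderiv_cos_inner_add (ξ : E) (θ : ℝ) (x v : E) :
    fderiv ℝ (fun y : E => Real.cos (inner ℝ ξ y + θ)) x v
      = -inner ℝ ξ v * Real.sin (inner ℝ ξ x + θ) := by
  have h : HasFDerivAt (fun y : E => inner ℝ ξ y + θ) (innerSL ℝ ξ) x :=
    (innerSL ℝ ξ).hasFDerivAt.add_const θ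
  rw [h.cos.fderiv]
  simp
  ring

lemma fderiv_sin_inner_add (ξ : E) (θ : ℝ) (x v : E) :
    fderiv ℝ (fun y : E => Real.sin (inner ℝ ξ y + θ)) x v
      = inner ℝ ξ v * Real.cos (inner ℝ ξ x + θ) := by
  have h : HasFDerivAt (fun y : E => inner ℝ ξ y + θ) (innerSL ℝ ξ) x :=
    (innerSL ℝ ξ).hasFDerivAt.add_const θ
  rw [h.sin.fderiv]
  simp
  ring

lemma contDiff_cos_inner_add {m : WithTop ℕ∞} (ξ : E) (θ : ℝ) :
    ContDiff ℝ m (fun y : E => Real.cos (inner ℝ ξ y + θ)) :=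
  ((contDiff_const.inner ℝ contDiff_id).add contDiff_const).cos

/-- Real plane waves are eigenfunctions of the Laplacian. The phase `θ` treats cosine and sine
together, since `θ = π / 2` gives `-sin`. -/
lemma laplacian_cos_inner_add [FiniteDimensional ℝ E] (ξ : E) (θ : ℝ) (x : E) :
    (Δ (fun y : E => Real.cos (inner ℝ ξ y + θ))) x
      = -(‖ξ‖ ^ 2 * Real.cos (inner ℝ ξ x + θ)) := by
  let b := stdOrthonormalBasis ℝ E
  rw [laplacian_eq_sum_fderiv_fderiv b (contDiff_cos_inner_add ξ θ)]
  simp only [fderiv_cos_inner_add]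
  have hd : Differentiable ℝ (fun y : E => Real.sin (inner ℝ ξ y + θ)) := by
    have : Differentiable ℝ (fun y : E => inner ℝ ξ y) := (innerSL ℝ ξ).differentiable
    fun_prop
  have h : ∀ i, fderiv ℝ (fun y => -inner ℝ ξ (b i) * Real.sin (inner ℝ ξ y + θ)) x (b i)
      = -(inner ℝ ξ (b i) ^ 2 * Real.cos (inner ℝ ξ x + θ)) := by
    intro i
    rw [fderiv_const_mul (hd x)]
    simp only [smul_apply, fderiv_sin_inner_add, smul_eq_mul]
    ring
  rw [Finset.sum_congr rfl fun i _ => h i, Finset.sum_neg_distrib, ← Finset.sum_mul]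
  have hp : ∑ i, inner ℝ ξ (b i) ^ 2 = ‖ξ‖ ^ 2 := by
    rw [← b.sum_sq_norm_inner_left ξ]
    simp
  rw [hp]

end ExplicitLaplacians

/-! ### Gaussian testing and integrability of the solution. -/

lemma integrable_exp_neg_mul_norm_sq {n : ℕ} {ε : ℝ} (hε : 0 < ε) :
    Integrable (fun x : EuclideanSpace ℝ (Fin n) => Real.exp (-ε * ‖x‖ ^ 2)) := by
  have h := (GaussianFourier.integrable_cexp_neg_mul_sq_norm_add_of_euclideanSpace
    (b := (ε : ℂ)) (by simpa using hε) 0 (0 : EuclideanSpace ℝ (Fin n))).re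
  refine h.congr (.of_forall fun x => ?_)
  simp only [zero_mul, add_zero]
  norm_cast

/-- Half of the Gaussian decay absorbs the factor `‖x‖ ^ 2`, through `t ≤ exp t`. -/
lemma integrable_norm_sq_mul_exp_neg_mul_norm_sq {n : ℕ} {ε : ℝ} (hε : 0 < ε) :
    Integrable (fun x : EuclideanSpace ℝ (Fin n) => ‖x‖ ^ 2 * Real.exp (-ε * ‖x‖ ^ 2)) := by
  refine ((integrable_exp_neg_mul_norm_sq (half_pos hε)).const_mul (2 / ε)).mono'
    (by fun_prop) (.of_forall fun x => ?_)
  rw [Real.norm_of_nonneg (by positivity)]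
  have h1 : ε / 2 * ‖x‖ ^ 2 ≤ Real.exp (ε / 2 * ‖x‖ ^ 2) :=
    (by linarith : ε / 2 * ‖x‖ ^ 2 ≤ ε / 2 * ‖x‖ ^ 2 + 1).trans (Real.add_one_le_exp _)
  have h2 : Real.exp (-(ε / 2) * ‖x‖ ^ 2)
      = Real.exp (ε / 2 * ‖x‖ ^ 2) * Real.exp (-ε * ‖x‖ ^ 2) := by
    rw [← Real.exp_add]
    ring_nf
  rw [h2, ← mul_assoc]
  gcongr
  calc ‖x‖ ^ 2 = 2 / ε * (ε / 2 * ‖x‖ ^ 2) := by field_simp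
    _ ≤ _ := by gcongr

/-- Testing a bounded weak solution of `-Δ u = a u` against a centred Gaussian. -/
lemma IsWeakSolution.integral_mul_gaussian_weight {n : ℕ} {a : ℝ}
    {u : EuclideanSpace ℝ (Fin n) → ℝ} (hu : IsWeakSolution (fun _ => a) u)
    (hbdd : MemLp u ∞ volume) {ε : ℝ} (hε : 0 < ε) :
    Integrable (fun x => u x *
      ((a - 2 * ε * n + 4 * ε ^ 2 * ‖x‖ ^ 2) * Real.exp (-ε * ‖x‖ ^ 2))) ∧
    ∫ x, u x * ((a - 2 * ε * n + 4 * ε ^ 2 * ‖x‖ ^ 2) * Real.exp (-ε * ‖x‖ ^ 2)) = 0 := by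
  have i0 := integrable_exp_neg_mul_norm_sq (n := n) hε
  have i2 := integrable_norm_sq_mul_exp_neg_mul_norm_sq (n := n) hε
  have hs : ContDiff ℝ ∞ (fun y : EuclideanSpace ℝ (Fin n) => Real.exp (-ε * ‖y‖ ^ 2)) :=
    (contDiff_const.mul (contDiff_norm_sq ℝ)).exp
  have h0 : Integrable (fun x => u x * Real.exp (-ε * ‖x‖ ^ 2)) := i0.mul_of_top_right hbdd
  have hlap : ∀ x, (Δ (fun y : EuclideanSpace ℝ (Fin n) => Real.exp (-ε * ‖y‖ ^ 2))) x
      = (4 * ε ^ 2 * ‖x‖ ^ 2 - 2 * ε * n) * Real.exp (-ε * ‖x‖ ^ 2) := fun x => by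
    rw [laplacian_exp_neg_mul_norm_sq, finrank_euclideanSpace_fin]
  have h2 : Integrable (fun x =>
      u x * (Δ (fun y : EuclideanSpace ℝ (Fin n) => Real.exp (-ε * ‖y‖ ^ 2))) x) := by
    refine Integrable.mul_of_top_right ?_ hbdd
    refine ((i2.const_mul (4 * ε ^ 2)).sub (i0.const_mul (2 * ε * n))).congr
      (.of_forall fun x => ?_)
    simp only [hlap, Pi.sub_apply]
    ring
  have h1 : ∀ i, Integrable fun x => u x * fderiv ℝ (fun y => Real.exp (-ε * ‖y‖ ^ 2)) x
      (EuclideanSpace.basisFun (Fin n) ℝ i) := by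
    intro i
    refine Integrable.mul_of_top_right ?_ hbdd
    refine ((i0.add i2).const_mul (2 * ε)).mono'
      ((hs.continuous_fderiv (by simp)).clm_apply continuous_const).aestronglyMeasurable
      (.of_forall fun x => ?_)
    rw [fderiv_exp_neg_mul_norm_sq, norm_mul, norm_mul, Real.norm_of_nonneg (Real.exp_pos _).le]
    have hi : ‖inner ℝ x (EuclideanSpace.basisFun (Fin n) ℝ i)‖ ≤ 1 + ‖x‖ ^ 2 := by
      refine (norm_inner_le_norm x _).trans ?_
      rw [(EuclideanSpace.basisFun (Fin n) ℝ).orthonormal.1 i]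
      nlinarith [sq_nonneg (‖x‖ - 1)]
    have he : ‖-2 * ε‖ = 2 * ε := by
      rw [norm_mul, Real.norm_of_nonneg hε.le]
      norm_num
    rw [he]
    calc 2 * ε * ‖inner ℝ x (EuclideanSpace.basisFun (Fin n) ℝ i)‖ * Real.exp (-ε * ‖x‖ ^ 2)
        ≤ 2 * ε * (1 + ‖x‖ ^ 2) * Real.exp (-ε * ‖x‖ ^ 2) := by gcongr
      _ = _ := by
        simp only [Pi.add_apply]
        ring
  have key := hu.integral_mul_laplacian hs h0 h1 h2
  have hsplit : ∀ x, u x * (Δ (fun y : EuclideanSpace ℝ (Fin n) => Real.exp (-ε * ‖y‖ ^ 2))) x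
      + a * (u x * Real.exp (-ε * ‖x‖ ^ 2))
      = u x * ((a - 2 * ε * n + 4 * ε ^ 2 * ‖x‖ ^ 2) * Real.exp (-ε * ‖x‖ ^ 2)) := fun x => by
    rw [hlap]
    ring
  simp_rw [← hsplit]
  refine ⟨h2.add (h0.const_mul a), ?_⟩
  rw [integral_add h2 (h0.const_mul a), integral_const_mul, key]
  ring

/-- Fatou's lemma as an integrability criterion. -/
lemma integrable_of_tendsto_of_integral_norm_le {α : Type*} [MeasurableSpace α] {μ : Measure α}
    {F : ℕ → α → ℝ} {f : α → ℝ} {K : ℝ} (hF : ∀ k, Integrable (F k) μ)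
    (hK : ∀ k, ∫ x, ‖F k x‖ ∂μ ≤ K)
    (hlim : ∀ᵐ x ∂μ, Tendsto (fun k => F k x) atTop (𝓝 (f x))) : Integrable f μ := by
  refine ⟨aestronglyMeasurable_of_tendsto_ae _ (fun k => (hF k).1) hlim, ?_⟩
  have hle : ∫⁻ x, ‖f x‖ₑ ∂μ ≤ ENNReal.ofReal K := by
    calc ∫⁻ x, ‖f x‖ₑ ∂μ = ∫⁻ x, liminf (fun k => ‖F k x‖ₑ) atTop ∂μ :=
          lintegral_congr_ae (hlim.mono fun x hx => hx.enorm.liminf_eq.symm)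
      _ ≤ liminf (fun k => ∫⁻ x, ‖F k x‖ₑ ∂μ) atTop :=
          lintegral_liminf_le' fun k => (hF k).1.enorm
      _ ≤ ENNReal.ofReal K := by
          refine liminf_le_of_frequently_le' (.of_forall fun k => ?_)
          rw [← ofReal_integral_norm_eq_lintegral_enorm (hF k)]
          exact ENNReal.ofReal_le_ofReal (hK k)
  exact hle.trans_lt ENNReal.ofReal_lt_top

/-- A bounded weak solution of `-Δ u = a u`, `a > 0`, which is nonnegative outside a ball is
integrable. -/
lemma IsWeakSolution.integrable_of_nonneg_near_infinity {n : ℕ} {a : ℝ} (ha : 0 < a)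
    {u : EuclideanSpace ℝ (Fin n) → ℝ} (hu : IsWeakSolution (fun _ => a) u)
    (hbdd : MemLp u ∞ volume) {R : ℝ} (hR : ∀ᵐ x, R < ‖x‖ → 0 ≤ u x) : Integrable u := by
  -- Starting the sequence at index `N` ensures `2 * ε k * n ≤ a` for every `k`, so all the weights
  -- are nonnegative.
  obtain ⟨N, hN⟩ := exists_nat_gt (2 * n / a)
  let ε : ℕ → ℝ := fun k => 1 / ((k + N : ℕ) + 1 : ℝ)
  have hε : ∀ k, 0 < ε k := fun k => by positivity
  have hε1 : ∀ k, ε k ≤ 1 := fun k => by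
    simp only [ε]
    rw [div_le_one (by positivity)]
    linarith [(Nat.cast_nonneg (k + N) : (0 : ℝ) ≤ _)]
  have hεn : ∀ k, 2 * ε k * n ≤ a := fun k => by
    have h1 : 2 * n < N * a := (div_lt_iff₀ ha).1 hN
    have h2 : 2 * ε k * n = 2 * n / ((k + N : ℕ) + 1 : ℝ) := by simp only [ε]; ring
    rw [h2, div_le_iff₀ (by positivity)]
    push_cast
    nlinarith [(Nat.cast_nonneg k : (0 : ℝ) ≤ k)]
  have hε0 : Tendsto ε atTop (𝓝 0) :=
    (tendsto_add_atTop_iff_nat N).2 (tendsto_one_div_add_atTop_nhds_zero_nat (𝕜 := ℝ))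
  let W : ℕ → EuclideanSpace ℝ (Fin n) → ℝ := fun k x =>
    (a - 2 * ε k * n + 4 * ε k ^ 2 * ‖x‖ ^ 2) * Real.exp (-ε k * ‖x‖ ^ 2)
  have hW0 : ∀ k x, 0 ≤ W k x := fun k x => by
    have := hεn k
    have : 0 ≤ a - 2 * ε k * n := by linarith
    positivity
  let B : Set (EuclideanSpace ℝ (Fin n)) := Metric.closedBall 0 R
  have hB : MeasurableSet B := Metric.isClosed_closedBall.measurableSet
  have hWB : ∀ k, ∀ x ∈ B, W k x ≤ a + 4 * R ^ 2 := fun k x hx => by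
    have hx' : ‖x‖ ≤ R := by simpa [B] using hx
    have h1 : Real.exp (-ε k * ‖x‖ ^ 2) ≤ 1 := by
      rw [Real.exp_le_one_iff]
      nlinarith [hε k, sq_nonneg ‖x‖]
    have h2 : 0 ≤ a - 2 * ε k * n := by linarith [hεn k]
    calc W k x ≤ (a - 2 * ε k * n + 4 * ε k ^ 2 * ‖x‖ ^ 2) * 1 := by
          simp only [W]
          gcongr
      _ ≤ (a - 0 + 4 * 1 ^ 2 * R ^ 2) * 1 := by
          have := hε k
          have := hε1 k
          gcongr
          positivity
      _ = _ := by ring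
  have hint : ∀ k, Integrable (fun x => u x * W k x) := fun k =>
    (hu.integral_mul_gaussian_weight hbdd (hε k)).1
  have hzero : ∀ k, ∫ x, u x * W k x = 0 := fun k =>
    (hu.integral_mul_gaussian_weight hbdd (hε k)).2
  have huB : IntegrableOn u B := (hu.1.integrableOn_isCompact (isCompact_closedBall 0 R))
  -- Fatou outside the ball: the weights converge pointwise to `a`, and the vanishing total integral
  -- bounds the outer mass by the inner one, where `hWB` is uniform in `k`.
  have hout : IntegrableOn (fun x => u x * a) Bᶜ := by
    refine integrable_of_tendsto_of_integral_norm_le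
      (F := fun k x => u x * W k x) (K := ∫ x in B, ‖u x‖ * (a + 4 * R ^ 2))
      (fun k => (hint k).integrableOn) (fun k => ?_) (.of_forall fun x => ?_)
    · have e1 : ∫ x in Bᶜ, ‖u x * W k x‖ = ∫ x in Bᶜ, u x * W k x := by
        refine setIntegral_congr_ae hB.compl ?_
        filter_upwards [hR] with x hx hxB
        rw [Real.norm_of_nonneg]
        exact mul_nonneg (hx (by simpa [B] using hxB)) (hW0 k x)
      have e2 : ∫ x in Bᶜ, u x * W k x = ∫ x in B, -(u x * W k x) := by
        rw [integral_neg]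
        linarith [integral_add_compl hB (hint k), hzero k]
      rw [e1, e2]
      refine setIntegral_mono_on (hint k).neg.integrableOn (huB.norm.mul_const _) hB ?_
      intro x hx
      calc -(u x * W k x) ≤ ‖u x * W k x‖ := (neg_le_abs _)
        _ = ‖u x‖ * W k x := by rw [norm_mul, Real.norm_of_nonneg (hW0 k x)]
        _ ≤ _ := by gcongr; exact hWB k x hx
    · have hc : Continuous fun t : ℝ =>
          u x * ((a - 2 * t * n + 4 * t ^ 2 * ‖x‖ ^ 2) * Real.exp (-t * ‖x‖ ^ 2)) := by fun_prop
      simpa [Function.comp_def, W] using (hc.tendsto 0).comp hε0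
  have hout' : IntegrableOn u Bᶜ := by
    refine (hout.mul_const a⁻¹).congr (.of_forall fun x => ?_)
    simp [ha.ne']
  rw [← integrableOn_univ, ← Set.union_compl_self B]
  exact huB.union hout'

/-! ### Fourier transform of an integrable solution. -/

/-- The cosine and sine transforms of an integrable weak solution of `-Δ u = a u` vanish off the
sphere `‖ξ‖² = a`. -/
lemma IsWeakSolution.integral_mul_cos_eq_zero {n : ℕ} {a : ℝ}
    {u : EuclideanSpace ℝ (Fin n) → ℝ} (hu : IsWeakSolution (fun _ => a) u)
    (hint : Integrable u) {ξ : EuclideanSpace ℝ (Fin n)} (hξ : ‖ξ‖ ^ 2 ≠ a) (θ : ℝ) :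
    ∫ x, u x * Real.cos (inner ℝ ξ x + θ) = 0 := by
  have hs : ContDiff ℝ ∞ (fun y => Real.cos (inner ℝ ξ y + θ)) := contDiff_cos_inner_add ξ θ
  have h0 : Integrable (fun x => u x * Real.cos (inner ℝ ξ x + θ)) :=
    hint.mul_bdd (c := 1) hs.continuous.aestronglyMeasurable
      (.of_forall fun x => Real.abs_cos_le_one _)
  have h1 : ∀ i, Integrable fun x => u x * fderiv ℝ (fun y => Real.cos (inner ℝ ξ y + θ)) x
      (EuclideanSpace.basisFun (Fin n) ℝ i) := by
    intro i
    refine hint.mul_bdd (c := ‖inner ℝ ξ (EuclideanSpace.basisFun (Fin n) ℝ i)‖)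
      ((hs.continuous_fderiv (by simp)).clm_apply continuous_const).aestronglyMeasurable
      (.of_forall fun x => ?_)
    rw [fderiv_cos_inner_add, norm_mul, norm_neg]
    exact mul_le_of_le_one_right (norm_nonneg _) (Real.abs_sin_le_one _)
  have hlap : ∀ x, u x * (Δ (fun y => Real.cos (inner ℝ ξ y + θ))) x
      = -‖ξ‖ ^ 2 * (u x * Real.cos (inner ℝ ξ x + θ)) := fun x => by
    rw [laplacian_cos_inner_add]
    ring
  have key := hu.integral_mul_laplacian hs h0 h1 (by simpa only [hlap] using h0.const_mul _)
  simp only [hlap] at key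
  rw [integral_const_mul] at key
  have : (‖ξ‖ ^ 2 - a) * ∫ x, u x * Real.cos (inner ℝ ξ x + θ) = 0 := by linarith
  exact (mul_eq_zero.1 this).resolve_left (sub_ne_zero.2 hξ)

open scoped FourierTransform in
/-- An integrable function whose Fourier transform vanishes almost everywhere is zero. -/
lemma ae_eq_zero_of_fourier_ae_eq_zero {V : Type*} [NormedAddCommGroup V] [InnerProductSpace ℝ V]
    [FiniteDimensional ℝ V] [MeasurableSpace V] [BorelSpace V] {f : V → ℂ} (hf : Integrable f)
    (h : ∀ᵐ ξ, 𝓕 f ξ = 0) : f =ᵐ[volume] 0 := by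
  refine ae_eq_zero_of_integral_contDiff_smul_eq_zero hf.locallyIntegrable fun g hg hgc => ?_
  have hg₁ : HasCompactSupport (Complex.ofRealCLM ∘ g) := hgc.comp_left rfl
  have hg₂ : ContDiff ℝ ∞ (Complex.ofRealCLM ∘ g) := by fun_prop
  -- Every smooth compactly supported `g` is the Fourier transform of a Schwartz function, so moving
  -- the transform onto `f` turns the pairing with `g` into an integral of `𝓕 f`.
  let ψ : SchwartzMap V ℂ := hg₁.toSchwartzMap hg₂
  have hψ : ∀ x, 𝓕 (𝓕⁻ ψ : SchwartzMap V ℂ) x = (g x : ℂ) := fun x => by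
    rw [FourierTransform.fourier_fourierInv_eq]
    rfl
  have adj : ∀ η : SchwartzMap V ℂ, ∫ ξ, 𝓕 f ξ • η ξ = ∫ x, f x • 𝓕 η x := fun η => by
    simpa using! VectorFourier.integral_fourierIntegral_smul_eq_flip (L := innerₗ V)
      Real.continuous_fourierChar continuous_inner hf (η.integrable (μ := volume))
  have key := adj (𝓕⁻ ψ)
  have hz : ∫ ξ, 𝓕 f ξ • (𝓕⁻ ψ : SchwartzMap V ℂ) ξ = 0 :=
    integral_eq_zero_of_ae (h.mono fun ξ hξ => by simp [hξ])
  rw [hz] at key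
  rw [key]
  refine integral_congr_ae (.of_forall fun x => ?_)
  simp only [hψ, smul_eq_mul, Complex.real_smul]
  ring

open scoped FourierTransform in
/-- An integrable weak solution of `-Δ u = a u`, `a > 0`, vanishes. -/
lemma IsWeakSolution.ae_eq_zero_of_integrable {n : ℕ} {a : ℝ} (ha : 0 < a)
    {u : EuclideanSpace ℝ (Fin n) → ℝ} (hu : IsWeakSolution (fun _ => a) u)
    (hint : Integrable u) : u =ᵐ[volume] 0 := by
  have hz : ∀ᵐ ξ : EuclideanSpace ℝ (Fin n), 𝓕 (fun x => (u x : ℂ)) ξ = 0 := by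
    -- The Fourier kernel is `exp (-2πi⟨x, ξ⟩)`, so the exceptional condition `‖2πξ‖² = a` is a
    -- sphere of radius `√a / (2π)`.
    have hr : √a / (2 * Real.pi) ≠ 0 := by positivity
    have hsph : ∀ᵐ ξ : EuclideanSpace ℝ (Fin n), ξ ∉ Metric.sphere 0 (√a / (2 * Real.pi)) :=
      measure_eq_zero_iff_ae_notMem.1 (Measure.addHaar_sphere_of_ne_zero volume 0 hr)
    filter_upwards [hsph] with ξ hξ
    have hξ' : ‖(2 * Real.pi) • ξ‖ ^ 2 ≠ a := by
      intro h
      apply hξ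
      have h2 : ‖(2 * Real.pi) • ξ‖ = √a := by rw [← h, Real.sqrt_sq (norm_nonneg _)]
      rw [norm_smul, Real.norm_of_nonneg (by positivity)] at h2
      rw [mem_sphere_zero_iff_norm, ← h2]
      field_simp
    have hcos := hu.integral_mul_cos_eq_zero hint hξ' 0
    have hsin := hu.integral_mul_cos_eq_zero hint hξ' (Real.pi / 2)
    have hker : ∀ x, Complex.exp (↑(-2 * Real.pi * inner ℝ x ξ) * Complex.I) • (u x : ℂ)
        = ((u x * Real.cos (inner ℝ ((2 * Real.pi) • ξ) x + 0) : ℝ) : ℂ)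
          + ((u x * Real.cos (inner ℝ ((2 * Real.pi) • ξ) x + Real.pi / 2) : ℝ) : ℂ)
            * Complex.I := by
      intro x
      rw [Complex.exp_mul_I, ← Complex.ofReal_cos, ← Complex.ofReal_sin, real_inner_smul_left,
        real_inner_comm, Real.cos_add_pi_div_two, add_zero, neg_mul, neg_mul, Real.cos_neg,
        Real.sin_neg, smul_eq_mul]
      push_cast
      ring
    have hi : ∀ θ : ℝ,
        Integrable fun x => u x * Real.cos (inner ℝ ((2 * Real.pi) • ξ) x + θ) := fun θ =>
      hint.mul_bdd (c := 1)
        (contDiff_cos_inner_add (m := 0) _ θ).continuous.aestronglyMeasurable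
        (.of_forall fun x => Real.abs_cos_le_one _)
    rw [Real.fourier_eq']
    simp only [hker]
    rw [integral_add (hi 0).ofReal ((hi _).ofReal.mul_const _), integral_mul_const,
      integral_complex_ofReal, integral_complex_ofReal, hcos, hsin]
    simp
  filter_upwards [ae_eq_zero_of_fourier_ae_eq_zero hint.ofReal hz] with x hx
  simpa using hx

/-! ### Sign changes near infinity. -/

lemma IsWeakSolution.neg {n : ℕ} {V u : EuclideanSpace ℝ (Fin n) → ℝ} (hu : IsWeakSolution V u) :
    IsWeakSolution V (-u) := by
  refine ⟨hu.1.neg, ?_, fun φ hφ hc => ?_⟩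
  · simpa only [Pi.neg_apply, mul_neg] using! hu.2.1.neg
  · simpa only [Pi.neg_apply, mul_neg, neg_mul, integral_neg, neg_inj] using hu.2.2 φ hφ hc

/-- A bounded eigenfunction with positive eigenvalue is negative on a set of positive measure
outside every ball. -/
lemma IsEigenfunction.volume_neg_pos {n : ℕ} {a : ℝ} (ha : 0 < a)
    {u : EuclideanSpace ℝ (Fin n) → ℝ} (hu : IsEigenfunction a u) (hbdd : MemLp u ∞ volume)
    (R : ℝ) : 0 < volume {x | R < ‖x‖ ∧ u x < 0} := by
  refine pos_iff_ne_zero.2 fun h => hu.2 ?_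
  refine hu.1.ae_eq_zero_of_integrable ha
    (hu.1.integrable_of_nonneg_near_infinity ha hbdd (R := R) ?_)
  filter_upwards [measure_eq_zero_iff_ae_notMem.1 h] with x hx hxR
  exact not_lt.1 fun hlt => hx ⟨hxR, hlt⟩

theorem theorem1p6 (n : ℕ) (hn : 1 ≤ n) (c : ℝ) (hc : c ≠ 0)
    (u : EuclideanSpace ℝ (Fin n) → ℝ) (hbdd : MemLp u ∞ volume)
    (hu : IsEigenfunction (c ^ 2) u) :
    ChangesSignNearInfinity u := by
  intro R
  have hc2 : 0 < c ^ 2 := by positivity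
  have hneg : IsEigenfunction (c ^ 2) (-u) := by
    refine ⟨hu.1.neg, fun h => hu.2 ?_⟩
    filter_upwards [h] with x hx
    simpa using hx
  refine ⟨?_, hu.volume_neg_pos hc2 hbdd R⟩
  simpa using hneg.volume_neg_pos hc2 hbdd.neg R
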